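/- **Setting.** Let $D,m,N,q\in\mathbb{N}=\{1,2,\dots\}$ with $m<N$, let $Z\subseteq\mathbb{R}^D$ be compact, let $\mathscr{R}_1,\dots,\mathscr{R}_N\in Z$, and let $\varepsilon>0$, $\widetilde\varepsilon>0$, $C>0$, $\lambda\ge 0$. Put $\Omega_{\mathrm{loc}}:=Z^m\subseteq\mathbb{R}^{Dm}$ and $A:=[-C,C]^D$; $\|\cdot\|$ denotes Euclidean norms and $\mathcal{M}_1(\cdot)$ Borel probability measures. For $x=(x_1,\dots,x_m)\in\Omega_{\mathrm{loc}}$ let $\pi(x):=(x_2,\dots,x_m)$ and, for $s=m,\dots,N-1$, $$\operatorname{dist}_s(x):=\|(\mathscr{R}_{s-m+1},\dots,\mathscr{R}_s)-x\|,\qquad \pi_s(x):=\frac{(\operatorname{dist}_s(x)+\widetilde\varepsilon)^{-1}}{\sum_{\ell=m}^{N-1}(\operatorname{dist}_\ell(x)+\widetilde\varepsilon)^{-1}},\qquad \widehat{\mathbb{P}}(x):=\sum_{s=m}^{N-1}\pi_s(x)\,\delta_{\mathscr{R}_{s+1}}\in\mathcal{M}_1(Z).$$ With $W_q(\mu,\nu):=\big(\inf_\gamma\int\|y-z\|^q\,\gamma(dy,dz)\big)^{1/q}$,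 the infimum being over all joint distributions $\gamma$ of $\mu,\nu\in\mathcal{M}_1(Z)$, define $$\mathcal{P}(x,a):=\mathcal{P}(x):=\big\{\delta_{\pi(x)}\otimes\mathbb{P}\ \big|\ \mathbb{P}\in\mathcal{M}_1(Z),\ W_q(\mathbb{P},\widehat{\mathbb{P}}(x))\le\varepsilon\big\}\subseteq\mathcal{M}_1(\Omega_{\mathrm{loc}}),\qquad (x,a)\in\Omega_{\mathrm{loc}}\times A.$$ For $x_0,x_1\in\Omega_{\mathrm{loc}}$ and $a\in A$ let $$r(x_0,a,x_1):=\sum_{i=1}^D a^i z^i-\lambda\,a^T\Sigma a,$$ where $z\in Z$ is the last (that is, $m$-th) component of $x_1$ and where $\Sigma$ is either the sample covariance $\frac1{N-1}\sum_{s=1}^N(\mathscr{R}_s-\mathrm{ER})(\mathscr{R}_s-\mathrm{ER})^T$ with $\mathrm{ER}:=\frac1N\sum_{s=1}^N\mathscr{R}_s$, or any other covariance matrix (a positive semidefinite matrix in $\mathbb{R}^{D\times D}$). **Assumptions.** Let $p\in\{0,1\}$. Let $\tau_p$ be the topology on $\mathcal{M}_1(\Omega_{\mathrm{loc}})$ in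 which $\mu_n\to\mu$ means $\int g\,d\mu_n\to\int g\,d\mu$ for all continuous $g:\Omega_{\mathrm{loc}}\to\mathbb{R}$ with $\sup_x|g(x)|/(1+\|x\|^p)<\infty$ (for $p=0$: weak convergence; here $\|x\|^0=1$). *Assumption 2.2* (for $\mathcal{P}$, with constant $C_P$): (i) $(x,a)\twoheadrightarrow\mathcal{P}(x,a)$ from $\Omega_{\mathrm{loc}}\times A$ to $(\mathcal{M}_1(\Omega_{\mathrm{loc}}),\tau_p)$ is nonempty, compact-valued and continuous, i.e. both upper and lower hemicontinuous; (ii) $C_P\ge1$ and $\int(1+\|y\|^p)\,\mathbb{P}(dy)\le C_P(1+\|x\|^p)$ for all $(x,a)$ and all $\mathbb{P}\in\mathcal{P}(x,a)$. *Assumption 2.4* (for $r$, a discount factor $\alpha<1$, and the same $p$ and $C_P$): (i) $r$ is continuous on $\Omega_{\mathrm{loc}}\times A\times\Omega_{\mathrm{loc}}$; (ii) there are $L>0$ and functions $\rho_0,\rho_A:[0,\infty]\to[0,\infty]$ with $\lim_{u\to0}\rho_\bullet(u)=0=\rho_\bullet(0)$ such that $|r(x_0,a,x_1)-r(x_0',a',x_1)|\le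 L(1+\|x_1\|^p)\big(\rho_0(\|x_0-x_0'\|)+\rho_A(\|a-a'\|)\big)$ for all $x_0,x_0',x_1\in\Omega_{\mathrm{loc}}$ and $a,a'\in A$; (iii) there is $C_r\ge1$ with $|r(x_0,a,x_1)|\le C_r(1+\|x_0\|^p+\|x_1\|^p)$ for all $x_0,x_1\in\Omega_{\mathrm{loc}}$ and $a\in A$; (iv) $0<\alpha<1/C_P$. **Proposition 4.1.** Let $p=0$. There is a constant $C_P$ such that $\mathcal{P}$ satisfies Assumption 2.2 with $C_P$ and such that, for every discount factor $\alpha\in(0,1)$, the reward function $r$ satisfies Assumption 2.4 with $C_P$ and $\alpha$. -/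

import Mathlib

open MeasureTheory Filter Topology
open scoped ENNReal

noncomputable section

namespace RobustMDP

section Setting

variable {ι κ : Type*} [Fintype ι] [Fintype κ]

/-- `C_p(X, ℝ)`: continuous real functions on `X ⊆ ℝ^ι` of polynomial growth at most of degree
`p`, i.e. `sup_{x ∈ X} |g x| / (1 + ‖x‖ ^ p) < ∞` (Euclidean norm). -/
def polyGrowth (p : ℕ) (X : Set (EuclideanSpace ℝ ι)) : Set (X → ℝ) :=
  {g | Continuous g ∧
    BddAbove (Set.range fun x : X => |g x| / (1 + ‖(x : EuclideanSpace ℝ ι)‖ ^ p))}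

/-- The topology `τ_p` on the probability measures on `X`: the coarsest topology for which
`μ ↦ ∫ g dμ` is continuous for every `g ∈ C_p(X, ℝ)`, so that `μ_n → μ` iff
`∫ g dμ_n → ∫ g dμ` for all `g ∈ C_p(X, ℝ)`. For `p = 0` the test functions are exactly the
bounded continuous functions (all integrable), and `τ_0` is the topology of weak convergence. -/
@[reducible]
def tau (p : ℕ) (X : Set (EuclideanSpace ℝ ι)) : TopologicalSpace (ProbabilityMeasure X) :=
  ⨅ g ∈ polyGrowth p X,
    TopologicalSpace.induced (fun μ : ProbabilityMeasure X => ∫ x, g x ∂(μ : Measure X))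
      inferInstance

/-- The standing assumption on the set of measures `(x, a) ↠ P (x, a)` on the state space `Ω`
with action set `A`, with growth constant `C_P`: the correspondence is nonempty, compact-valued
and continuous (upper and lower hemicontinuous) into `(M_1(Ω), τ_p)`, and
`∫ (1 + ‖y‖ ^ p) dℙ ≤ C_P (1 + ‖x‖ ^ p)` for every `ℙ ∈ P (x, a)`. -/
structure MeasureAssumption (p : ℕ) {Ω : Set (EuclideanSpace ℝ ι)}
    {A : Set (EuclideanSpace ℝ κ)} (P : Ω × A → Set (ProbabilityMeasure Ω)) (C_P : ℝ) :
    Prop where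
  exponent : p = 0 ∨ p = 1
  nonempty : ∀ xa, (P xa).Nonempty
  compact : ∀ xa, @IsCompact (ProbabilityMeasure Ω) (tau p Ω) (P xa)
  upperHemicontinuous : @UpperHemicontinuous (Ω × A) (ProbabilityMeasure Ω) _ (tau p Ω) P
  lowerHemicontinuous : @LowerHemicontinuous (Ω × A) (ProbabilityMeasure Ω) _ (tau p Ω) P
  one_le_const : 1 ≤ C_P
  growth : ∀ (x : Ω) (a : A), ∀ ℙ ∈ P (x, a),
    ∫⁻ y, ENNReal.ofReal (1 + ‖(y : EuclideanSpace ℝ ι)‖ ^ p) ∂(ℙ : Measure Ω) ≤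
      ENNReal.ofReal (C_P * (1 + ‖(x : EuclideanSpace ℝ ι)‖ ^ p))

/-- A modulus of continuity: `ρ : [0, ∞] → [0, ∞]` with `lim_{x → 0} ρ x = 0 = ρ 0`. -/
def IsModulus (ρ : ℝ≥0∞ → ℝ≥0∞) : Prop :=
  ρ 0 = 0 ∧ Tendsto ρ (𝓝 0) (𝓝 0)

/-- The standing assumption on the reward function `r` and the discount factor `α`, where
`p` and `C_P` are those of the assumption on the set of measures. -/
structure RewardAssumption (p : ℕ) {Ω : Set (EuclideanSpace ℝ ι)}
    {A : Set (EuclideanSpace ℝ κ)} (r : Ω → A → Ω → ℝ) (C_P α : ℝ) : Prop where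
  continuous : Continuous fun t : Ω × A × Ω => r t.1 t.2.1 t.2.2
  modulus : ∃ L : ℝ, 0 < L ∧ ∃ ρ₀ ρA : ℝ≥0∞ → ℝ≥0∞, IsModulus ρ₀ ∧ IsModulus ρA ∧
    ∀ (x₀ x₀' x₁ : Ω) (a a' : A),
      ENNReal.ofReal |r x₀ a x₁ - r x₀' a' x₁| ≤
        ENNReal.ofReal (L * (1 + ‖(x₁ : EuclideanSpace ℝ ι)‖ ^ p)) *
          (ρ₀ (ENNReal.ofReal ‖(x₀ : EuclideanSpace ℝ ι) - x₀'‖) +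
            ρA (ENNReal.ofReal ‖(a : EuclideanSpace ℝ κ) - a'‖))
  bound : ∃ C_r : ℝ, 1 ≤ C_r ∧ ∀ (x₀ x₁ : Ω) (a : A),
    |r x₀ a x₁| ≤
      C_r * (1 + ‖(x₀ : EuclideanSpace ℝ ι)‖ ^ p + ‖(x₁ : EuclideanSpace ℝ ι)‖ ^ p)
  discount_pos : 0 < α
  discount_lt_one : α < 1
  discount_lt : α < 1 / C_P

end Setting

section Wasserstein

variable {ι : Type*} [Fintype ι] {X : Set (EuclideanSpace ℝ ι)}

/-- The `q`-Wasserstein distance on `X ⊆ ℝ^ι` with respect to the Euclidean norm, with values in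
`[0, ∞]`: the infimum is over all joint distributions with marginals `μ` and `ν`. -/
def wasserstein (q : ℕ) (μ ν : Measure X) : ℝ≥0∞ :=
  (⨅ (γ : Measure (X × X)) (_ : γ.map Prod.fst = μ ∧ γ.map Prod.snd = ν),
    ∫⁻ z, ENNReal.ofReal
      (‖(z.1 : EuclideanSpace ℝ ι) - (z.2 : EuclideanSpace ℝ ι)‖ ^ q) ∂γ) ^ (1 / (q : ℝ))

/-- The closed `q`-Wasserstein ball of radius `ε` around `ν`. -/
def wassersteinBall (q : ℕ) (ε : ℝ) (ν : Measure X) : Set (ProbabilityMeasure X) :=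
  {ℙ | wasserstein q (ℙ : Measure X) ν ≤ ENNReal.ofReal ε}

end Wasserstein

section Portfolio

variable {D : ℕ} {Z : Set (EuclideanSpace ℝ (Fin D))}

/-- `Z ^ m` as a subset of the Euclidean space `ℝ^{m D}`: every one of the `m` blocks of length
`D` lies in `Z`. -/
def states (Z : Set (EuclideanSpace ℝ (Fin D))) (m : ℕ) :
    Set (EuclideanSpace ℝ (Fin m × Fin D)) :=
  {x | ∀ i : Fin m, WithLp.toLp 2 (fun j : Fin D => x (i, j)) ∈ Z}

/-- The `i`-th component (counted from `0`) of a state in `Z ^ m`. -/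
def block {m : ℕ} (x : states Z m) (i : Fin m) : Z :=
  ⟨WithLp.toLp 2 (fun j : Fin D => (x : EuclideanSpace ℝ (Fin m × Fin D)) (i, j)), x.2 i⟩

/-- The state in `Z ^ m` with given components. -/
def ofBlocks {m : ℕ} (z : Fin m → Z) : states Z m :=
  ⟨WithLp.toLp 2 (fun ij : Fin m × Fin D => (z ij.1 : EuclideanSpace ℝ (Fin D)) ij.2),
    fun i => (z i).2⟩

/-- The projection `π (x_1, …, x_m) = (x_2, …, x_m)`. -/
def proj {m : ℕ} (x : states Z m) : states Z (m - 1) :=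
  ofBlocks fun i => block x ⟨i + 1, by omega⟩

/-- The identification `Z ^ (m - 1) × Z → Z ^ m` that appends a last component (`m ≥ 1`). -/
def append {m : ℕ} (u : states Z (m - 1) × Z) : states Z m :=
  ofBlocks fun i => if h : (i : ℕ) < m - 1 then block u.1 ⟨i, h⟩ else u.2

/-- The `m` consecutive past returns `(ℛ_{s-m+1}, …, ℛ_s)`, for `s ≥ m`. -/
def window (ℛ : ℕ → Z) (m s : ℕ) : states Z m :=
  ofBlocks fun i => ℛ (s - m + 1 + i)

/-- `dist_s(x) = ‖(ℛ_{s-m+1}, …, ℛ_s) - x‖`, with the Euclidean norm on `ℝ^{m D}`. -/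
def windowDist (ℛ : ℕ → Z) {m : ℕ} (s : ℕ) (x : states Z m) : ℝ :=
  ‖(window ℛ m s : EuclideanSpace ℝ (Fin m × Fin D)) - x‖

/-- The weight `π_s(x) = (dist_s(x) + ε')⁻¹ / ∑_{ℓ=m}^{N-1} (dist_ℓ(x) + ε')⁻¹`. -/
def weight (ℛ : ℕ → Z) (N : ℕ) (ε' : ℝ) {m : ℕ} (s : ℕ) (x : states Z m) : ℝ :=
  (windowDist ℛ s x + ε')⁻¹ / ∑ l ∈ Finset.Icc m (N - 1), (windowDist ℛ l x + ε')⁻¹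

/-- The distance-weighted empirical measure `∑_{s=m}^{N-1} π_s(x) δ_{ℛ_{s+1}}` on `Z`. -/
def empirical (ℛ : ℕ → Z) (N : ℕ) (ε' : ℝ) {m : ℕ} (x : states Z m) : Measure Z :=
  ∑ s ∈ Finset.Icc m (N - 1), ENNReal.ofReal (weight ℛ N ε' s x) • Measure.dirac (ℛ (s + 1))

/-- The set of controls `[-C, C]^D`. -/
def actions (D : ℕ) (C : ℝ) : Set (EuclideanSpace ℝ (Fin D)) :=
  {a | ∀ i, a i ∈ Set.Icc (-C) C}

/-- The ambiguity set `{δ_{π(x)} ⊗ ℙ | ℙ in the q-Wasserstein ball of radius ε around the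
weighted empirical measure at x}`, as probability measures on `Z ^ m`. -/
def ambiguity (ℛ : ℕ → Z) (N m : ℕ) (ε' ε C : ℝ) (q : ℕ) :
    states Z m × actions D C → Set (ProbabilityMeasure (states Z m)) :=
  fun xa => {Q | ∃ ℙ ∈ wassersteinBall q ε (empirical ℛ N ε' xa.1),
    (Q : Measure (states Z m)) =
      ((Measure.dirac (proj xa.1)).prod (ℙ : Measure Z)).map append}

/-- The mean `ER = (1 / N) ∑_{s=1}^N ℛ_s` of the past returns. -/
def sampleMean (ℛ : ℕ → Z) (N : ℕ) : Fin D → ℝ :=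
  fun i => (1 / (N : ℝ)) * ∑ s ∈ Finset.Icc 1 N, (ℛ s : EuclideanSpace ℝ (Fin D)) i

/-- The covariance estimate `(1 / (N - 1)) ∑_{s=1}^N (ℛ_s - ER) (ℛ_s - ER)ᵀ`. -/
def sampleCovariance (ℛ : ℕ → Z) (N : ℕ) : Matrix (Fin D) (Fin D) ℝ :=
  Matrix.of fun i j => (1 / ((N : ℝ) - 1)) * ∑ s ∈ Finset.Icc 1 N,
    ((ℛ s : EuclideanSpace ℝ (Fin D)) i - sampleMean ℛ N i) *
      ((ℛ s : EuclideanSpace ℝ (Fin D)) j - sampleMean ℛ N j)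

/-- The mean-variance reward `r(x₀, a, x₁) = ∑ i, a^i z^i - lam (aᵀ S a)`, where `z` is the last
of the `m` components of `x₁`. -/
def reward {m : ℕ} (hm : 1 ≤ m) {C : ℝ} (lam : ℝ) (S : Matrix (Fin D) (Fin D) ℝ) :
    states Z m → actions D C → states Z m → ℝ :=
  fun _ a x₁ =>
    ∑ i, (a : EuclideanSpace ℝ (Fin D)) i *
        (block x₁ ⟨m - 1, by omega⟩ : EuclideanSpace ℝ (Fin D)) i
      - lam * ∑ i, ∑ j, (a : EuclideanSpace ℝ (Fin D)) i * S i j *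
          (a : EuclideanSpace ℝ (Fin D)) j

end Portfolio

end RobustMDP

end

noncomputable section

namespace RobustMDP

open scoped NNReal

/-! ### Weak convergence and hemicontinuity criteria. -/

section Topology

variable {ι : Type*} [Fintype ι]

/-! For p = 0 everything reduces to weak convergence (`tau_zero_eq`), and compactness of Z makes the
space of probability measures on Z × Z compact. A law lies in the Wasserstein ball exactly when it
is the first marginal of a plan of cost at most ε ^ q onto the centre (`mem_wassersteinBall_iff`).
The ambiguity sets are therefore continuous images of the fibres of a closed set of plans
(`ambiguity_eq_image`), which gives compactness and upper hemicontinuity.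

Lower hemicontinuity comes from a continuous selection through any given ℙ in the ball at x₀. The
empirical measures share their atoms and have positive continuous weights, so a multiple κ(x) of the
centre at x₀ fits below the centre at x, with κ continuous and κ(x₀) = 1. Moving κ(x) ℙ by the old
plan and leaving the rest of the new centre in place costs no more than before
(`exists_continuous_selection_wassersteinBall`).

The growth constant is C_P = 1, so every α in (0, 1) is below 1 / C_P. The reward ignores the
current state, and boundedness of Z and of the actions makes it bounded and Lipschitz in the action.
-/

/-- `τ_0` is the topology of weak convergence of probability measures. -/
lemma tau_zero_eq (X : Set (EuclideanSpace ℝ ι)) :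
    tau 0 X = (inferInstance : TopologicalSpace (ProbabilityMeasure X)) := by
  apply le_antisymm
  · rw [← continuous_id_iff_le]
    refine (@ProbabilityMeasure.continuous_iff_forall_continuous_integral X _ _ _
      (ProbabilityMeasure X) (tau 0 X) id).2 fun f => ?_
    have hf : (f : X → ℝ) ∈ polyGrowth 0 X := by
      refine ⟨f.continuous, ‖f‖, ?_⟩
      rintro _ ⟨x, rfl⟩
      have h1 : |f x| ≤ ‖f‖ := f.norm_coe_le_norm x
      have h2 := abs_nonneg (f x)
      simp only [pow_zero]
      linarith
    rw [continuous_iff_le_induced]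
    exact iInf₂_le (f : X → ℝ) hf
  · refine le_iInf₂ fun g hg => ?_
    rw [← continuous_iff_le_induced]
    obtain ⟨hc, M, hM⟩ := hg
    let f : BoundedContinuousFunction X ℝ :=
      -- The factor 2 is the growth weight 1 + ‖x‖ ^ 0.
      BoundedContinuousFunction.ofNormedAddCommGroup g hc (2 * M) fun x => by
        have := hM ⟨x, rfl⟩
        simp only [pow_zero] at this
        rw [Real.norm_eq_abs]
        linarith
    exact ProbabilityMeasure.continuous_integral_boundedContinuousFunction f

variable {X Y K : Type*} [TopologicalSpace X] [TopologicalSpace Y] [TopologicalSpace K]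

/-- The image under a continuous map of the fibres of a closed relation with values in a compact
space is upper hemicontinuous. -/
lemma upperHemicontinuous_image_of_isClosed [CompactSpace K] {G : Set (X × K)} (hG : IsClosed G)
    {Ψ : X × K → Y} (hΨ : Continuous Ψ) :
    UpperHemicontinuous fun x => (fun k => Ψ (x, k)) '' {k | (x, k) ∈ G} := by
  rw [upperHemicontinuous_iff_forall_isOpen]
  intro x u hu hx
  -- The bad points are a projection of a closed set along the compact factor K, hence form a closed
  -- set.
  have hcl : IsClosed (Prod.fst '' (G ∩ Ψ ⁻¹' uᶜ)) :=
    isClosedMap_fst_of_compactSpace _ (hG.inter (hu.isClosed_compl.preimage hΨ))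
  have hmem : x ∈ (Prod.fst '' (G ∩ Ψ ⁻¹' uᶜ))ᶜ := by
    rintro ⟨⟨x', k⟩, ⟨hk, hku⟩, rfl⟩
    exact hku (hx ⟨k, hk, rfl⟩)
  filter_upwards [hcl.isOpen_compl.mem_nhds hmem] with x' hx'
  rintro _ ⟨k, hk, rfl⟩
  by_contra hku
  exact hx' ⟨(x', k), ⟨hk, hku⟩, rfl⟩

/-- A correspondence with a continuous selection through every point of its graph is lower
hemicontinuous. -/
lemma lowerHemicontinuous_of_selection {F : X → Set Y}
    (h : ∀ x, ∀ y ∈ F x, ∃ g : X → Y, Continuous g ∧ g x = y ∧ ∀ x', g x' ∈ F x') :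
    LowerHemicontinuous F := by
  intro x u ⟨hu, y, hy, hyu⟩
  obtain ⟨g, hg, rfl, hgF⟩ := h x y hy
  filter_upwards [hg.continuousAt.preimage_mem_nhds (hu.mem_nhds hyu)] with x' hx'
  exact ⟨hu, g x', hgF x', hx'⟩

end Topology

/-! ### Transport plans and Wasserstein balls on a compact set. -/

section Transport

variable {ι : Type*} [Fintype ι] {Z : Set (EuclideanSpace ℝ ι)}

/-- The cost `∫ ‖y - z‖ ^ q γ(dy, dz)` of a transport plan `γ`. -/
def transportCost (q : ℕ) (γ : Measure (Z × Z)) : ℝ≥0∞ :=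
  ∫⁻ z, ENNReal.ofReal
    (‖(z.1 : EuclideanSpace ℝ ι) - (z.2 : EuclideanSpace ℝ ι)‖ ^ q) ∂γ

/-- On a compact space the cost function is bounded and continuous, hence a test function for weak
convergence. -/
lemma continuous_transportCost [CompactSpace Z] (q : ℕ) :
    Continuous fun γ : ProbabilityMeasure (Z × Z) => transportCost q (γ : Measure (Z × Z)) :=
  ProbabilityMeasure.continuous_lintegral_continuousMap
    (⟨fun z => Real.toNNReal
      (‖(z.1 : EuclideanSpace ℝ ι) - (z.2 : EuclideanSpace ℝ ι)‖ ^ q), by fun_prop⟩ :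
      C(Z × Z, ℝ≥0))

lemma transportCost_add (q : ℕ) (γ γ' : Measure (Z × Z)) :
    transportCost q (γ + γ') = transportCost q γ + transportCost q γ' :=
  lintegral_add_measure _ _ _

lemma transportCost_smul (q : ℕ) (c : ℝ≥0∞) (γ : Measure (Z × Z)) :
    transportCost q (c • γ) = c * transportCost q γ :=
  lintegral_smul_measure _ _

/-- Mass left in place is free; q = 0 is excluded because 0 ^ 0 = 1. -/
lemma transportCost_diag {q : ℕ} (hq : 1 ≤ q) (μ : Measure Z) :
    transportCost q (μ.map fun z => (z, z)) = 0 := by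
  rw [transportCost, lintegral_map (by fun_prop) (by fun_prop)]
  simp [show q ≠ 0 by omega]

lemma wasserstein_le_iff {q : ℕ} (hq : 1 ≤ q) {ε : ℝ} (hε : 0 ≤ ε) (μ ν : Measure Z) :
    wasserstein q μ ν ≤ ENNReal.ofReal ε ↔
      (⨅ (γ : Measure (Z × Z)) (_ : γ.map Prod.fst = μ ∧ γ.map Prod.snd = ν),
        transportCost q γ) ≤ ENNReal.ofReal (ε ^ q) := by
  have hq' : (0 : ℝ) < q := by exact_mod_cast hq
  rw [wasserstein, one_div, ENNReal.rpow_inv_le_iff hq', ENNReal.rpow_natCast,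
    ← ENNReal.ofReal_pow hε]
  rfl

/-- Membership in a closed Wasserstein ball is witnessed by a transport plan: on a compact space
the infimum in the Wasserstein distance is attained. -/
lemma mem_wassersteinBall_iff [CompactSpace Z] {q : ℕ} (hq : 1 ≤ q) {ε : ℝ} (hε : 0 ≤ ε)
    (ν ℙ : ProbabilityMeasure Z) :
    ℙ ∈ wassersteinBall q ε (ν : Measure Z) ↔
      ∃ γ : ProbabilityMeasure (Z × Z), γ.map measurable_fst.aemeasurable = ℙ ∧
        γ.map measurable_snd.aemeasurable = ν ∧
        transportCost q (γ : Measure (Z × Z)) ≤ ENNReal.ofReal (ε ^ q) := by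
  rw [wassersteinBall, Set.mem_ofPred_eq, wasserstein_le_iff hq hε]
  constructor
  · intro h
    let S : Set (ProbabilityMeasure (Z × Z)) :=
      {γ | γ.map measurable_fst.aemeasurable = ℙ ∧ γ.map measurable_snd.aemeasurable = ν}
    have hS : IsCompact S :=
      ((isClosed_eq (ProbabilityMeasure.continuous_map continuous_fst) continuous_const).inter
        (isClosed_eq (ProbabilityMeasure.continuous_map continuous_snd)
          continuous_const)).isCompact
    have hne : S.Nonempty :=
      ⟨ℙ.prod ν, ProbabilityMeasure.map_fst_prod ℙ ν, ProbabilityMeasure.map_snd_prod ℙ ν⟩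
    obtain ⟨γ, hγ, hmin⟩ := hS.exists_isMinOn hne (continuous_transportCost q).continuousOn
    refine ⟨γ, hγ.1, hγ.2, le_trans (le_iInf₂ fun γ' hγ' => ?_) h⟩
    -- The infimum ranges over arbitrary measures; a marginal of mass one forces total mass one.
    have hp : IsProbabilityMeasure γ' := by
      have : IsProbabilityMeasure (γ'.map Prod.fst) := by rw [hγ'.1]; infer_instance
      exact Measure.isProbabilityMeasure_of_map Prod.fst
    exact hmin (a := ⟨γ', hp⟩) ⟨Subtype.ext hγ'.1, Subtype.ext hγ'.2⟩
  · rintro ⟨γ, h1, h2, h3⟩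
    refine le_trans (iInf₂_le (γ : Measure (Z × Z)) ⟨?_, ?_⟩) h3
    · rw [← h1]; rfl
    · rw [← h2]; rfl

lemma self_mem_wassersteinBall [CompactSpace Z] {q : ℕ} (hq : 1 ≤ q) {ε : ℝ} (hε : 0 ≤ ε)
    (ν : ProbabilityMeasure Z) : ν ∈ wassersteinBall q ε (ν : Measure Z) := by
  have hd : Measurable fun z : Z => (z, z) := by fun_prop
  refine (mem_wassersteinBall_iff hq hε ν ν).2 ⟨ν.map hd.aemeasurable, ?_, ?_, ?_⟩
  · apply Subtype.ext
    change ((ν : Measure Z).map _).map Prod.fst = (ν : Measure Z)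
    rw [Measure.map_map measurable_fst hd]
    exact Measure.map_id
  · apply Subtype.ext
    change ((ν : Measure Z).map _).map Prod.snd = (ν : Measure Z)
    rw [Measure.map_map measurable_snd hd]
    exact Measure.map_id
  · exact (transportCost_diag hq _).le.trans zero_le

/-- If `ℙ` lies in the ball around `ν₀`, if `κ ≤ 1` and `κ ν₀ + ρ = ν`, then `κ ℙ + ρ` is a
probability measure in the ball around `ν`: transport `κ ℙ` as before and leave `ρ` in place. -/
lemma exists_mem_wassersteinBall_of_add_eq [CompactSpace Z] {q : ℕ} (hq : 1 ≤ q) {ε : ℝ}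
    (hε : 0 ≤ ε) {ν₀ ν ℙ : ProbabilityMeasure Z} (hℙ : ℙ ∈ wassersteinBall q ε (ν₀ : Measure Z))
    {κ : ℝ≥0∞} (hκ : κ ≤ 1) {ρ : Measure Z} (h : κ • (ν₀ : Measure Z) + ρ = ν) :
    ∃ ℙ' ∈ wassersteinBall q ε (ν : Measure Z), (ℙ' : Measure Z) = κ • (ℙ : Measure Z) + ρ := by
  obtain ⟨γ, h1, h2, h3⟩ := (mem_wassersteinBall_iff hq hε ν₀ ℙ).1 hℙ
  have hd : Measurable fun z : Z => (z, z) := by fun_prop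
  -- The diagonal part carries ρ at no cost, and the scaled plan costs at most as much as γ.
  let γ' : Measure (Z × Z) := κ • (γ : Measure (Z × Z)) + ρ.map fun z => (z, z)
  have hfst : γ'.map Prod.fst = κ • (ℙ : Measure Z) + ρ := by
    rw [Measure.map_add _ _ measurable_fst, Measure.map_smul, Measure.map_map measurable_fst hd,
      ← h1]
    exact congrArg _ Measure.map_id
  have hsnd : γ'.map Prod.snd = ν := by
    rw [Measure.map_add _ _ measurable_snd, Measure.map_smul, Measure.map_map measurable_snd hd,
      ← h, ← h2]
    exact congrArg _ Measure.map_id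
  have hp : IsProbabilityMeasure γ' := by
    have : IsProbabilityMeasure (γ'.map Prod.snd) := by rw [hsnd]; infer_instance
    exact Measure.isProbabilityMeasure_of_map Prod.snd
  let Γ : ProbabilityMeasure (Z × Z) := ⟨γ', hp⟩
  refine ⟨Γ.map measurable_fst.aemeasurable, (mem_wassersteinBall_iff hq hε ν _).2
    ⟨Γ, rfl, Subtype.ext hsnd, ?_⟩, hfst⟩
  calc transportCost q γ' = κ * transportCost q (γ : Measure (Z × Z)) := by
        rw [transportCost_add, transportCost_smul, transportCost_diag hq, add_zero]
    _ ≤ 1 * transportCost q (γ : Measure (Z × Z)) := by gcongr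
    _ ≤ ENNReal.ofReal (ε ^ q) := by rwa [one_mul]

end Transport

/-! ### Continuous selections for finitely supported centres. -/

section FiniteSupport

variable {ι X : Type*} [Fintype ι] [TopologicalSpace X] {Z : Set (EuclideanSpace ℝ ι)}

lemma integral_sum_ofReal_smul_dirac (I : Finset ℕ) (w : ℕ → ℝ) (hw : ∀ s ∈ I, 0 ≤ w s)
    (z : ℕ → Z) (f : BoundedContinuousFunction Z ℝ) :
    ∫ y, f y ∂(∑ s ∈ I, ENNReal.ofReal (w s) • Measure.dirac (z s)) =
      ∑ s ∈ I, w s * f (z s) := by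
  rw [integral_finsetSum_measure]
  · refine Finset.sum_congr rfl fun s hs => ?_
    rw [integral_smul_measure, integral_dirac, ENNReal.toReal_ofReal (hw s hs), smul_eq_mul]
  · intro s _
    exact (f.integrable _).smul_measure ENNReal.ofReal_ne_top

/-- The scaling factor by which one can shrink weights `w₀` so that they fit below `w`. -/
def fitFactor (I : Finset ℕ) (w₀ w : ℕ → ℝ) : ℝ := ∏ s ∈ I, min 1 (w s / w₀ s)

variable {I : Finset ℕ} {w₀ w : ℕ → ℝ}

lemma fitFactor_nonneg (h₀ : ∀ s ∈ I, 0 < w₀ s) (h : ∀ s ∈ I, 0 < w s) :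
    0 ≤ fitFactor I w₀ w :=
  Finset.prod_nonneg fun s hs => le_min zero_le_one (div_pos (h s hs) (h₀ s hs)).le

lemma fitFactor_le_one (h₀ : ∀ s ∈ I, 0 < w₀ s) (h : ∀ s ∈ I, 0 < w s) :
    fitFactor I w₀ w ≤ 1 :=
  Finset.prod_le_one (fun s hs => le_min zero_le_one (div_pos (h s hs) (h₀ s hs)).le)
    fun _ _ => min_le_left _ _

/-- All factors of the product lie in [0, 1], so the product is at most the single ratio w s / w₀ s.
-/
lemma fitFactor_mul_le (h₀ : ∀ s ∈ I, 0 < w₀ s) (h : ∀ s ∈ I, 0 < w s) {s : ℕ} (hs : s ∈ I) :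
    fitFactor I w₀ w * w₀ s ≤ w s := by
  have hpos : ∀ t ∈ I, 0 ≤ min 1 (w t / w₀ t) := fun t ht =>
    le_min zero_le_one (div_pos (h t ht) (h₀ t ht)).le
  rw [← le_div_iff₀ (h₀ s hs), fitFactor, ← Finset.mul_prod_erase I _ hs]
  calc min 1 (w s / w₀ s) * ∏ t ∈ I.erase s, min 1 (w t / w₀ t)
      ≤ (w s / w₀ s) * 1 := by
        refine mul_le_mul (min_le_right _ _) ?_ ?_ (div_pos (h s hs) (h₀ s hs)).le
        · exact Finset.prod_le_one (fun t ht => hpos t (Finset.mem_of_mem_erase ht))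
            fun _ _ => min_le_left _ _
        · exact Finset.prod_nonneg fun t ht => hpos t (Finset.mem_of_mem_erase ht)
    _ = w s / w₀ s := mul_one _

lemma fitFactor_self (h₀ : ∀ s ∈ I, 0 < w₀ s) : fitFactor I w₀ w₀ = 1 :=
  Finset.prod_eq_one fun s hs => by rw [div_self (h₀ s hs).ne', min_self]

/-- If the centres of Wasserstein balls are measures with common finite support and positive
weights varying continuously, then there is a continuous selection through each element of each
ball. -/
lemma exists_continuous_selection_wassersteinBall [CompactSpace Z] {q : ℕ} (hq : 1 ≤ q) {ε : ℝ}
    (hε : 0 ≤ ε) {I : Finset ℕ} {w : ℕ → X → ℝ} (hw : ∀ s ∈ I, ∀ x, 0 < w s x)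
    (hwc : ∀ s ∈ I, Continuous (w s)) {z : ℕ → Z} {ν : X → ProbabilityMeasure Z}
    (hν : ∀ x, (ν x : Measure Z) = ∑ s ∈ I, ENNReal.ofReal (w s x) • Measure.dirac (z s))
    (x₀ : X) {ℙ : ProbabilityMeasure Z} (hℙ : ℙ ∈ wassersteinBall q ε (ν x₀ : Measure Z)) :
    ∃ g : X → ProbabilityMeasure Z, Continuous g ∧ g x₀ = ℙ ∧
      ∀ x, g x ∈ wassersteinBall q ε (ν x : Measure Z) := by
  let κ : X → ℝ := fun x => fitFactor I (fun s => w s x₀) (fun s => w s x)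
  have hκ0 : ∀ x, 0 ≤ κ x := fun x =>
    fitFactor_nonneg (fun s hs => hw s hs x₀) (fun s hs => hw s hs x)
  have hκ1 : ∀ x, κ x ≤ 1 := fun x =>
    fitFactor_le_one (fun s hs => hw s hs x₀) (fun s hs => hw s hs x)
  have hκw : ∀ x, ∀ s ∈ I, κ x * w s x₀ ≤ w s x := fun x s hs =>
    fitFactor_mul_le (fun s hs => hw s hs x₀) (fun s hs => hw s hs x) hs
  have hκc : Continuous κ :=
    continuous_finsetProd _ fun s hs => continuous_const.min ((hwc s hs).div_const _)
  -- The part of the new centre not covered by the scaled old one.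
  let ρ : X → Measure Z := fun x =>
    ∑ s ∈ I, ENNReal.ofReal (w s x - κ x * w s x₀) • Measure.dirac (z s)
  have hsum : ∀ x, ENNReal.ofReal (κ x) • (ν x₀ : Measure Z) + ρ x = ν x := by
    intro x
    rw [hν, hν, Finset.smul_sum, ← Finset.sum_add_distrib]
    refine Finset.sum_congr rfl fun s hs => ?_
    rw [smul_smul, ← add_smul, ← ENNReal.ofReal_mul (hκ0 x),
      ← ENNReal.ofReal_add (mul_nonneg (hκ0 x) (hw s hs x₀).le) (sub_nonneg.2 (hκw x s hs)),
      add_sub_cancel]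
  choose g hgB hg using fun x => exists_mem_wassersteinBall_of_add_eq hq hε hℙ
    (ENNReal.ofReal_le_one.2 (hκ1 x)) (hsum x)
  refine ⟨g, ?_, ?_, hgB⟩
  · rw [ProbabilityMeasure.continuous_iff_forall_continuous_integral]
    intro f
    -- Against a test function, the selection depends on x only through the continuous real
    -- functions κ and `w s`.
    have hint : ∀ x, ∫ y, f y ∂(g x : Measure Z) =
        κ x * ∫ y, f y ∂(ℙ : Measure Z) + ∑ s ∈ I, (w s x - κ x * w s x₀) * f (z s) := by
      intro x
      have hρ : IsFiniteMeasure (ρ x) :=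
        isFiniteMeasure_of_le (ν x : Measure Z) (by rw [← hsum x]; exact Measure.le_add_left le_rfl)
      rw [hg, integral_add_measure ((f.integrable _).smul_measure ENNReal.ofReal_ne_top)
        (f.integrable _), integral_smul_measure, ENNReal.toReal_ofReal (hκ0 x), smul_eq_mul,
        integral_sum_ofReal_smul_dirac I _ (fun s hs => sub_nonneg.2 (hκw x s hs))]
    simp_rw [hint]
    exact (hκc.mul_const _).add (continuous_finsetSum _ fun s hs =>
      ((hwc s hs).sub (hκc.mul_const _)).mul_const _)
  -- At x₀ the factor is 1, so the remainder vanishes and ℙ itself is left.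
  · apply Subtype.ext
    have h1 : κ x₀ = 1 := fitFactor_self fun s hs => hw s hs x₀
    change (g x₀ : Measure Z) = (ℙ : Measure Z)
    rw [hg]
    simp [ρ, h1]

end FiniteSupport

/-! ### The ambiguity correspondence. -/

section Portfolio

variable {D : ℕ} {Z : Set (EuclideanSpace ℝ (Fin D))} {m : ℕ}

lemma continuous_block (i : Fin m) : Continuous fun x : states Z m => block x i := by
  unfold block
  fun_prop

lemma continuous_ofBlocks : Continuous (ofBlocks : (Fin m → Z) → states Z m) := by
  unfold ofBlocks
  fun_prop

lemma continuous_proj : Continuous (proj : states Z m → states Z (m - 1)) :=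
  continuous_ofBlocks.comp (continuous_pi fun _ => continuous_block _)

lemma continuous_append : Continuous (append : states Z (m - 1) × Z → states Z m) := by
  refine continuous_ofBlocks.comp (continuous_pi fun i => ?_)
  by_cases h : (i : ℕ) < m - 1
  · simp only [h, dite_true]
    exact (continuous_block _).comp continuous_fst
  · simpa only [h, dite_false] using continuous_snd

lemma continuous_windowDist (ℛ : ℕ → Z) (s : ℕ) :
    Continuous (windowDist ℛ s : states Z m → ℝ) := by
  unfold windowDist
  fun_prop

/-- The shift ε' keeps the inverse finite and positive even when x equals a past window; continuity
and strict positivity of the weights rest on this. -/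
lemma inv_windowDist_add_pos (ℛ : ℕ → Z) {ε' : ℝ} (hε' : 0 < ε') (s : ℕ) (x : states Z m) :
    0 < (windowDist ℛ s x + ε')⁻¹ :=
  inv_pos.2 (add_pos_of_nonneg_of_pos (norm_nonneg _) hε')

lemma sum_inv_windowDist_add_pos (ℛ : ℕ → Z) {N : ℕ} (hmN : m < N) {ε' : ℝ} (hε' : 0 < ε')
    (x : states Z m) : 0 < ∑ l ∈ Finset.Icc m (N - 1), (windowDist ℛ l x + ε')⁻¹ :=
  Finset.sum_pos (fun l _ => inv_windowDist_add_pos ℛ hε' l x)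
    (Finset.nonempty_Icc.2 (by omega))

lemma weight_pos (ℛ : ℕ → Z) {N : ℕ} (hmN : m < N) {ε' : ℝ} (hε' : 0 < ε') (s : ℕ)
    (x : states Z m) : 0 < weight ℛ N ε' s x :=
  div_pos (inv_windowDist_add_pos ℛ hε' s x) (sum_inv_windowDist_add_pos ℛ hmN hε' x)

lemma sum_weight (ℛ : ℕ → Z) {N : ℕ} (hmN : m < N) {ε' : ℝ} (hε' : 0 < ε') (x : states Z m) :
    ∑ s ∈ Finset.Icc m (N - 1), weight ℛ N ε' s x = 1 := by
  unfold weight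
  rw [← Finset.sum_div, div_self (sum_inv_windowDist_add_pos ℛ hmN hε' x).ne']

lemma continuous_weight (ℛ : ℕ → Z) {N : ℕ} (hmN : m < N) {ε' : ℝ} (hε' : 0 < ε') (s : ℕ) :
    Continuous (weight ℛ N ε' s : states Z m → ℝ) := by
  have h : ∀ l, Continuous fun x : states Z m => (windowDist ℛ l x + ε')⁻¹ := fun l =>
    ((continuous_windowDist ℛ l).add continuous_const).inv₀ fun x =>
      (inv_pos.1 (inv_windowDist_add_pos ℛ hε' l x)).ne'
  exact (h s).div (continuous_finsetSum _ fun l _ => h l) fun x =>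
    (sum_inv_windowDist_add_pos ℛ hmN hε' x).ne'

lemma isProbabilityMeasure_empirical (ℛ : ℕ → Z) {N : ℕ} (hmN : m < N) {ε' : ℝ} (hε' : 0 < ε')
    (x : states Z m) : IsProbabilityMeasure (empirical ℛ N ε' x) := by
  constructor
  simp only [empirical, Measure.coe_finsetSum, Finset.sum_apply, Measure.smul_apply,
    measure_univ, smul_eq_mul, mul_one]
  rw [← ENNReal.ofReal_sum_of_nonneg fun s _ => (weight_pos ℛ hmN hε' s x).le,
    sum_weight ℛ hmN hε' x, ENNReal.ofReal_one]

/-- The distance-weighted empirical measure as a probability measure. -/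
def empiricalProba (ℛ : ℕ → Z) {N : ℕ} (hmN : m < N) {ε' : ℝ} (hε' : 0 < ε') (x : states Z m) :
    ProbabilityMeasure Z :=
  ⟨empirical ℛ N ε' x, isProbabilityMeasure_empirical ℛ hmN hε' x⟩

lemma continuous_empiricalProba (ℛ : ℕ → Z) {N : ℕ} (hmN : m < N) {ε' : ℝ} (hε' : 0 < ε') :
    Continuous (empiricalProba ℛ hmN hε' : states Z m → ProbabilityMeasure Z) := by
  rw [ProbabilityMeasure.continuous_iff_forall_continuous_integral]
  intro f
  have hint : ∀ x : states Z m, ∫ y, f y ∂(empiricalProba ℛ hmN hε' x : Measure Z) =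
      ∑ s ∈ Finset.Icc m (N - 1), weight ℛ N ε' s x * f (ℛ (s + 1)) := fun x =>
    integral_sum_ofReal_smul_dirac (Finset.Icc m (N - 1)) (fun s => weight ℛ N ε' s x)
      (fun s _ => (weight_pos ℛ hmN hε' s x).le) (fun s => ℛ (s + 1)) f
  simp_rw [hint]
  exact continuous_finsetSum _ fun s _ => (continuous_weight ℛ hmN hε' s).mul_const _

/-- The law `δ_{π(x)} ⊗ ℙ` of the next state when the next return has law `ℙ`. -/
def nextLaw (x : states Z m) (ℙ : ProbabilityMeasure Z) : ProbabilityMeasure (states Z m) :=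
  ((diracProba (proj x)).prod ℙ).map continuous_append.measurable.aemeasurable

lemma continuous_nextLaw {X : Type*} [TopologicalSpace X] {f : X → states Z m}
    {g : X → ProbabilityMeasure Z} (hf : Continuous f) (hg : Continuous g) :
    Continuous fun t => nextLaw (f t) (g t) :=
  (ProbabilityMeasure.continuous_map continuous_append).comp
    (ProbabilityMeasure.continuous_prod.comp
      ((continuous_diracProba.comp (continuous_proj.comp hf)).prodMk hg))

variable {N q : ℕ} {ε ε' C : ℝ}

lemma mem_ambiguity_iff (ℛ : ℕ → Z) (hmN : m < N) (hε' : 0 < ε')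
    (xa : states Z m × actions D C) (Q : ProbabilityMeasure (states Z m)) :
    Q ∈ ambiguity ℛ N m ε' ε C q xa ↔
      ∃ ℙ ∈ wassersteinBall q ε (empiricalProba ℛ hmN hε' xa.1 : Measure Z),
        nextLaw xa.1 ℙ = Q := by
  refine exists_congr fun ℙ => and_congr Iff.rfl ⟨fun h => Subtype.ext h.symm, ?_⟩
  rintro rfl
  rfl

/-- The graph of the correspondence sending a state and an action to the transport plans of
cost at most `ε ^ q` whose second marginal is the empirical measure. -/
def planGraph (ℛ : ℕ → Z) (hmN : m < N) (hε' : 0 < ε') (q : ℕ) (ε C : ℝ) :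
    Set ((states Z m × actions D C) × ProbabilityMeasure (Z × Z)) :=
  {t | t.2.map measurable_snd.aemeasurable = empiricalProba ℛ hmN hε' t.1.1 ∧
    transportCost q (t.2 : Measure (Z × Z)) ≤ ENNReal.ofReal (ε ^ q)}

lemma isClosed_planGraph [CompactSpace Z] (ℛ : ℕ → Z) (hmN : m < N) (hε' : 0 < ε') :
    IsClosed (planGraph ℛ hmN hε' q ε C) :=
  (isClosed_eq ((ProbabilityMeasure.continuous_map continuous_snd).comp continuous_snd)
    ((continuous_empiricalProba ℛ hmN hε').comp (continuous_fst.comp continuous_fst))).inter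
    (isClosed_le ((continuous_transportCost q).comp continuous_snd) continuous_const)

/-- The law of the next state when the law of the next return is the first marginal of a plan. -/
def planLaw (t : (states Z m × actions D C) × ProbabilityMeasure (Z × Z)) :
    ProbabilityMeasure (states Z m) :=
  nextLaw t.1.1 (t.2.map measurable_fst.aemeasurable)

lemma continuous_planLaw :
    Continuous (planLaw : (states Z m × actions D C) × ProbabilityMeasure (Z × Z) → _) :=
  continuous_nextLaw (continuous_fst.comp continuous_fst)
    ((ProbabilityMeasure.continuous_map continuous_fst).comp continuous_snd)

/-- Passing from laws to plans turns the moving ball into fibres of a closed relation over a compact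
space. -/
lemma ambiguity_eq_image [CompactSpace Z] (ℛ : ℕ → Z) (hmN : m < N) (hε' : 0 < ε') (hq : 1 ≤ q)
    (hε : 0 ≤ ε) (xa : states Z m × actions D C) :
    ambiguity ℛ N m ε' ε C q xa =
      (fun γ => planLaw (xa, γ)) '' {γ | (xa, γ) ∈ planGraph ℛ hmN hε' q ε C} := by
  ext Q
  rw [mem_ambiguity_iff ℛ hmN hε']
  constructor
  · rintro ⟨ℙ, hℙ, rfl⟩
    obtain ⟨γ, rfl, h2, h3⟩ := (mem_wassersteinBall_iff hq hε _ _).1 hℙ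
    exact ⟨γ, ⟨h2, h3⟩, rfl⟩
  · rintro ⟨γ, ⟨h2, h3⟩, rfl⟩
    exact ⟨_, (mem_wassersteinBall_iff hq hε _ _).2 ⟨γ, rfl, h2, h3⟩, rfl⟩

lemma nonempty_ambiguity [CompactSpace Z] (ℛ : ℕ → Z) (hmN : m < N) (hε' : 0 < ε') (hq : 1 ≤ q)
    (hε : 0 ≤ ε) (xa : states Z m × actions D C) :
    (ambiguity ℛ N m ε' ε C q xa).Nonempty :=
  ⟨_, (mem_ambiguity_iff ℛ hmN hε' xa _).2 ⟨_, self_mem_wassersteinBall hq hε _, rfl⟩⟩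

lemma isCompact_ambiguity [CompactSpace Z] (ℛ : ℕ → Z) (hmN : m < N) (hε' : 0 < ε') (hq : 1 ≤ q)
    (hε : 0 ≤ ε) (xa : states Z m × actions D C) :
    IsCompact (ambiguity ℛ N m ε' ε C q xa) := by
  rw [ambiguity_eq_image ℛ hmN hε' hq hε]
  exact ((isClosed_planGraph ℛ hmN hε').preimage
    (Continuous.prodMk_right xa)).isCompact.image
    (continuous_planLaw.comp (Continuous.prodMk_right xa))

lemma upperHemicontinuous_ambiguity [CompactSpace Z] (ℛ : ℕ → Z) (hmN : m < N) (hε' : 0 < ε')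
    (hq : 1 ≤ q) (hε : 0 ≤ ε) : UpperHemicontinuous (ambiguity ℛ N m ε' ε C q) := by
  rw [funext (ambiguity_eq_image ℛ hmN hε' hq hε)]
  exact upperHemicontinuous_image_of_isClosed (isClosed_planGraph ℛ hmN hε')
    continuous_planLaw

lemma lowerHemicontinuous_ambiguity [CompactSpace Z] (ℛ : ℕ → Z) (hmN : m < N) (hε' : 0 < ε')
    (hq : 1 ≤ q) (hε : 0 ≤ ε) : LowerHemicontinuous (ambiguity ℛ N m ε' ε C q) := by
  refine lowerHemicontinuous_of_selection fun xa Q hQ => ?_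
  obtain ⟨ℙ, hℙ, rfl⟩ := (mem_ambiguity_iff ℛ hmN hε' xa Q).1 hQ
  obtain ⟨g, hg, hgx, hgB⟩ := exists_continuous_selection_wassersteinBall hq hε
    (I := Finset.Icc m (N - 1)) (w := fun s x => weight ℛ N ε' s x) (z := fun s => ℛ (s + 1))
    (ν := empiricalProba ℛ hmN hε') (fun s _ x => weight_pos ℛ hmN hε' s x)
    (fun s _ => continuous_weight ℛ hmN hε' s) (fun _ => rfl) xa.1 hℙ
  refine ⟨fun xa' => nextLaw xa'.1 (g xa'.1),
    continuous_nextLaw continuous_fst (hg.comp continuous_fst), ?_,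
    fun xa' => (mem_ambiguity_iff ℛ hmN hε' xa' _).2 ⟨_, hgB xa'.1, rfl⟩⟩
  simp only [hgx]

lemma measureAssumption_ambiguity (hZ : IsCompact Z) (ℛ : ℕ → Z) (hmN : m < N) (hε' : 0 < ε')
    (hq : 1 ≤ q) (hε : 0 ≤ ε) : MeasureAssumption 0 (ambiguity ℛ N m ε' ε C q) 1 := by
  have : CompactSpace Z := isCompact_iff_compactSpace.1 hZ
  refine ⟨Or.inl rfl, nonempty_ambiguity ℛ hmN hε' hq hε, ?_, ?_, ?_, le_rfl, ?_⟩
  · rw [tau_zero_eq]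
    exact isCompact_ambiguity ℛ hmN hε' hq hε
  · rw [tau_zero_eq]
    exact upperHemicontinuous_ambiguity ℛ hmN hε' hq hε
  · rw [tau_zero_eq]
    exact lowerHemicontinuous_ambiguity ℛ hmN hε' hq hε
  -- For p = 0 both sides equal 2, since ℙ has mass one.
  · intro x a ℙ _
    simp

end Portfolio

/-! ### Continuity and bounds of the reward. -/

section Reward

variable {D m : ℕ} {Z : Set (EuclideanSpace ℝ (Fin D))} {C : ℝ}

lemma continuous_reward (hm : 1 ≤ m) (lam : ℝ) (S : Matrix (Fin D) (Fin D) ℝ) :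
    Continuous fun t : states Z m × actions D C × states Z m =>
      reward hm lam S t.1 t.2.1 t.2.2 := by
  have h : Continuous fun t : states Z m × actions D C × states Z m =>
      block t.2.2 ⟨m - 1, by omega⟩ := (continuous_block _).comp (by fun_prop)
  unfold reward
  fun_prop

lemma abs_apply_le_of_mem_actions {a : EuclideanSpace ℝ (Fin D)} (ha : a ∈ actions D C)
    (i : Fin D) : |a i| ≤ C :=
  abs_le.2 (ha i)

/-- The linear part is controlled by |z i| ≤ R. In the quadratic part, changing one factor of a i *
a j at a time gives two terms, each at most C ‖a - a'‖, hence the 2 * C. -/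
lemma abs_reward_sub_le (hm : 1 ≤ m) {lam : ℝ} (hlam : 0 ≤ lam) (S : Matrix (Fin D) (Fin D) ℝ)
    {R : ℝ} (hR : ∀ z ∈ Z, ‖z‖ ≤ R) (x₀ x₀' x₁ : states Z m) (a a' : actions D C) :
    |reward hm lam S x₀ a x₁ - reward hm lam S x₀' a' x₁| ≤
      (∑ _i : Fin D, R + lam * ∑ i, ∑ j, 2 * C * |S i j|) *
        ‖(a : EuclideanSpace ℝ (Fin D)) - a'‖ := by
  set b : EuclideanSpace ℝ (Fin D) := a.1
  set b' : EuclideanSpace ℝ (Fin D) := a'.1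
  set z : EuclideanSpace ℝ (Fin D) := (block x₁ ⟨m - 1, by omega⟩).1
  have hz : ∀ i, |z i| ≤ R := fun i =>
    (PiLp.norm_apply_le z i).trans (hR z (block x₁ ⟨m - 1, by omega⟩).2)
  have hd : ∀ i, |b i - b' i| ≤ ‖b - b'‖ := fun i => PiLp.norm_apply_le (b - b') i
  have hb : ∀ i, |b i| ≤ C := abs_apply_le_of_mem_actions a.2
  have hb' : ∀ i, |b' i| ≤ C := abs_apply_le_of_mem_actions a'.2
  have hlin : |∑ i, (b i - b' i) * z i| ≤ (∑ _i : Fin D, R) * ‖b - b'‖ := by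
    rw [Finset.sum_mul]
    refine (Finset.abs_sum_le_sum_abs _ _).trans (Finset.sum_le_sum fun i _ => ?_)
    rw [abs_mul, mul_comm]
    exact mul_le_mul (hz i) (hd i) (abs_nonneg _) ((abs_nonneg _).trans (hz i))
  have hterm : ∀ i j, |b i * S i j * b j - b' i * S i j * b' j| ≤
      2 * C * |S i j| * ‖b - b'‖ := by
    intro i j
    have h1 : |(b i - b' i) * b j| ≤ ‖b - b'‖ * C := by
      rw [abs_mul]
      exact mul_le_mul (hd i) (hb j) (abs_nonneg _) (norm_nonneg _)
    have h2 : |b' i * (b j - b' j)| ≤ C * ‖b - b'‖ := by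
      rw [abs_mul]
      exact mul_le_mul (hb' i) (hd j) (abs_nonneg _) ((abs_nonneg _).trans (hb' i))
    calc |b i * S i j * b j - b' i * S i j * b' j|
        = |S i j| * |(b i - b' i) * b j + b' i * (b j - b' j)| := by
          rw [← abs_mul]
          congr 1
          ring
      _ ≤ |S i j| * (‖b - b'‖ * C + C * ‖b - b'‖) := by
          gcongr
          exact (abs_add_le _ _).trans (add_le_add h1 h2)
      _ = 2 * C * |S i j| * ‖b - b'‖ := by ring
  have hquad : |∑ i, ∑ j, (b i * S i j * b j - b' i * S i j * b' j)| ≤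
      (∑ i, ∑ j, 2 * C * |S i j|) * ‖b - b'‖ := by
    simp_rw [Finset.sum_mul]
    exact (Finset.abs_sum_le_sum_abs _ _).trans (Finset.sum_le_sum fun i _ =>
      (Finset.abs_sum_le_sum_abs _ _).trans (Finset.sum_le_sum fun j _ => hterm i j))
  have hsplit : reward hm lam S x₀ a x₁ - reward hm lam S x₀' a' x₁ =
      ∑ i, (b i - b' i) * z i -
        lam * ∑ i, ∑ j, (b i * S i j * b j - b' i * S i j * b' j) := by
    simp only [reward, sub_mul, Finset.sum_sub_distrib, b, b', z]
    ring
  rw [hsplit, add_mul, mul_assoc]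
  refine (abs_sub _ _).trans (add_le_add hlin ?_)
  rw [abs_mul, abs_of_nonneg hlam]
  exact mul_le_mul_of_nonneg_left hquad hlam

lemma abs_reward_le (hm : 1 ≤ m) {lam : ℝ} (hlam : 0 ≤ lam) (S : Matrix (Fin D) (Fin D) ℝ)
    {R : ℝ} (hR : ∀ z ∈ Z, ‖z‖ ≤ R) (x₀ x₁ : states Z m) (a : actions D C) :
    |reward hm lam S x₀ a x₁| ≤ ∑ _i : Fin D, C * R + lam * ∑ i, ∑ j, C * |S i j| * C := by
  set b : EuclideanSpace ℝ (Fin D) := a.1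
  set z : EuclideanSpace ℝ (Fin D) := (block x₁ ⟨m - 1, by omega⟩).1
  have hz : ∀ i, |z i| ≤ R := fun i =>
    (PiLp.norm_apply_le z i).trans (hR z (block x₁ ⟨m - 1, by omega⟩).2)
  have hb : ∀ i, |b i| ≤ C := abs_apply_le_of_mem_actions a.2
  refine (abs_sub _ _).trans (add_le_add ?_ ?_)
  · refine (Finset.abs_sum_le_sum_abs _ _).trans (Finset.sum_le_sum fun i _ => ?_)
    rw [abs_mul]
    exact mul_le_mul (hb i) (hz i) (abs_nonneg _) ((abs_nonneg _).trans (hb i))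
  · rw [abs_mul, abs_of_nonneg hlam]
    refine mul_le_mul_of_nonneg_left ?_ hlam
    refine (Finset.abs_sum_le_sum_abs _ _).trans (Finset.sum_le_sum fun i _ =>
      (Finset.abs_sum_le_sum_abs _ _).trans (Finset.sum_le_sum fun j _ => ?_))
    have hC : 0 ≤ C := (abs_nonneg _).trans (hb i)
    rw [abs_mul, abs_mul]
    gcongr
    · exact hb i
    · exact hb j

lemma isModulus_zero : IsModulus fun _ => 0 := ⟨rfl, tendsto_const_nhds⟩

lemma isModulus_id : IsModulus fun u => u := ⟨rfl, tendsto_id⟩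

lemma rewardAssumption_reward (hZ : IsCompact Z) (hm : 1 ≤ m) {lam : ℝ} (hlam : 0 ≤ lam)
    (S : Matrix (Fin D) (Fin D) ℝ) {α : ℝ} (h0 : 0 < α) (h1 : α < 1) :
    RewardAssumption 0 (reward (Z := Z) (C := C) hm lam S) 1 α := by
  obtain ⟨R, hR⟩ := hZ.isBounded.exists_norm_le
  refine ⟨continuous_reward hm lam S, ?_, ?_, h0, h1, by simpa using h1⟩
  · set K : ℝ := ∑ _i : Fin D, R + lam * ∑ i, ∑ j, 2 * C * |S i j|
    -- The reward does not depend on x₀, so ρ₀ = 0 works, and the Lipschitz bound gives ρA = id.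
    -- `|K| + 1` secures L > 0 whatever the sign of K: R may be negative if Z is empty.
    refine ⟨|K| + 1, by positivity, _, _, isModulus_zero, isModulus_id,
      fun x₀ x₀' x₁ a a' => ?_⟩
    rw [zero_add, ← ENNReal.ofReal_mul (by positivity)]
    refine ENNReal.ofReal_le_ofReal ((abs_reward_sub_le hm hlam S hR x₀ x₀' x₁ a a').trans
      (mul_le_mul_of_nonneg_right ?_ (norm_nonneg _)))
    have hK := le_abs_self K
    have hK' := abs_nonneg K
    rw [pow_zero]
    change K ≤ _
    linarith
  · set K : ℝ := ∑ _i : Fin D, C * R + lam * ∑ i, ∑ j, C * |S i j| * C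
    -- Here the added 1 secures C_r ≥ 1.
    refine ⟨|K| + 1, by linarith [abs_nonneg K], fun x₀ x₁ a =>
      (abs_reward_le hm hlam S hR x₀ x₁ a).trans ?_⟩
    have hK := le_abs_self K
    have hK' := abs_nonneg K
    rw [pow_zero, pow_zero]
    change K ≤ _
    linarith

end Reward

end RobustMDP

end

open RobustMDP in
/-- `ℛ 1, …, ℛ N` are the past realized returns (other values of `ℛ` play no role). Part one: the
ambiguity correspondence satisfies the assumption on the set of measures with `p = 0`. Part two:
the reward satisfies the assumption on rewards with `p = 0`, the same constant `C_P` and every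
discount factor in `(0, 1)`, for the covariance estimate from the past returns and for every other
covariance (positive semidefinite) matrix. -/
theorem proposition4p1 {D : ℕ} (Z : Set (EuclideanSpace ℝ (Fin D))) (hZ : IsCompact Z)
    (m N : ℕ) (hm : 1 ≤ m) (hmN : m < N) (ℛ : ℕ → Z)
    (q : ℕ) (hq : 1 ≤ q) (ε ε' : ℝ) (hε : 0 < ε) (hε' : 0 < ε')
    (C : ℝ) (hC : 0 < C) (lam : ℝ) (hlam : 0 ≤ lam) :
    ∃ C_P : ℝ,
      MeasureAssumption 0 (ambiguity ℛ N m ε' ε C q) C_P ∧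
      ∀ α : ℝ, 0 < α → α < 1 →
        RewardAssumption 0 (reward (Z := Z) (C := C) hm lam (sampleCovariance ℛ N)) C_P α ∧
        ∀ S : Matrix (Fin D) (Fin D) ℝ, S.PosSemidef →
          RewardAssumption 0 (reward (Z := Z) (C := C) hm lam S) C_P α := by
  exact ⟨1, measureAssumption_ambiguity hZ ℛ hmN hε' hq hε.le, fun α h0 h1 =>
    ⟨rewardAssumption_reward hZ hm hlam _ h0 h1, fun S _ =>
      rewardAssumption_reward hZ hm hlam S h0 h1⟩⟩
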